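/- **Setting.** Let $n\ge 1$. Dyadic intervals are the intervals $I=(m2^k,(m+1)2^k)$ with $k,m\in\mathbb Z$; write $|I|$ for the length and $c(I)$ for the center of $I$. A dyadic rectangle is a product $R=R_1\times\cdots\times R_n\subset\mathbb R^n$ of dyadic intervals; for $t>0$, $tR$ is the rectangle with the same center as $R$ and with all side lengths multiplied by $t$. The shadow of a collection $\mathcal U$ of dyadic rectangles is $\operatorname{sh}(\mathcal U)=\bigcup_{R\in\mathcal U}R$. Let $w\in L^2(\mathbb R)$ be a complex-valued function for which the functions $w_I(x)=|I|^{-1/2}w\big((x-c(I))/|I|\big)$, $I$ dyadic, form an orthonormal system in $L^2(\mathbb R)$ (for instance an orthonormal basis of the Hardy space $H^2(\mathbb R)$), and put $v_R(x)=\prod_{j=1}^n w_{R_j}(x_j)$ and $\langle f,v_R\rangle=\int_{\mathbb R^n} f\,\overline{v_R}\,dx$. Define $$\|f\|_{BMO}=\sup_{W}\Big[\frac1{|W|}\sum_{R\subset W}|\langle f,v_R\rangle|^2\Big]^{1/2},\qquad \|b\|_{BMO_{-1}}=\sup_{\mathcal U'}\Big[\frac1{|\operatorname{sh}(\mathcal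 U')|}\sum_{R\in\mathcal U'}|\langle b,v_R\rangle|^2\Big]^{1/2},$$ where $W$ ranges over the open subsets of $\mathbb R^n$ of finite measure, and $\mathcal U'$ over the collections of dyadic rectangles with shadow of finite measure for which there are a coordinate $k$ and a dyadic interval $I$ with $R_k=I$ for all $R\in\mathcal U'$ (empty sets and collections contribute $0$). **Lemma.** For all $\delta,\epsilon>0$ there is a finite constant $K_{\delta,\epsilon}$, depending only on $n,\delta,\epsilon$, such that the following holds. Let $b$ be a function on $\mathbb R^n$ for which all the integrals $\langle b,v_R\rangle$ converge absolutely and $\|b\|_{BMO_{-1}}<\infty$, and let $\mathcal U$ be a collection of dyadic rectangles whose shadow has finite measure. Then there are a measurable set $V\supset\operatorname{sh}(\mathcal U)$ with $|V|\le(1+\delta)|\operatorname{sh}(\mathcal U)|$ and numbers $\operatorname{emb}(R)\ge1$, $R\in\mathcal U$, such that $$\operatorname{emb}(R)\,R\subset V\qquad\text{for all }R\in\mathcal U,$$ and such that the series $\sum_{R\in\mathcal U}\operatorname{emb}(R)^{-(n+\epsilon)}\langle b,v_R\rangle v_R$ converges unconditionally in $L^2(\mathbb R^n)$ and satisfies $$\Big\|\sum_{R\in\mathcal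 U}\operatorname{emb}(R)^{-(n+\epsilon)}\langle b,v_R\rangle\, v_R\Big\|_{BMO}\le K_{\delta,\epsilon}\,\|b\|_{BMO_{-1}}.$$ -/

import Mathlib

open MeasureTheory Filter Topology
open scoped ENNReal NNReal

noncomputable section

/-- A dyadic interval of the real line, coded by `(k, m)`: the interval
`(m * 2 ^ k, (m + 1) * 2 ^ k)`. -/
abbrev DyadicInterval : Type := ℤ × ℤ

/-- The length `2 ^ k` of a dyadic interval. -/
def DyadicInterval.length (I : DyadicInterval) : ℝ := (2 : ℝ) ^ I.1

/-- The center of a dyadic interval. -/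
def DyadicInterval.center (I : DyadicInterval) : ℝ := ((I.2 : ℝ) + 1 / 2) * I.length

/-- The dyadic interval as a subset of the real line. -/
def DyadicInterval.toSet (I : DyadicInterval) : Set ℝ :=
  Set.Ioo ((I.2 : ℝ) * I.length) (((I.2 : ℝ) + 1) * I.length)

/-- A dyadic rectangle of `ℝⁿ`, a product of `n` dyadic intervals. -/
abbrev DyadicRect (n : ℕ) : Type := Fin n → DyadicInterval

/-- The dyadic rectangle as a subset of `ℝⁿ`. -/
def DyadicRect.toSet {n : ℕ} (R : DyadicRect n) : Set (Fin n → ℝ) :=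
  {x | ∀ j, x j ∈ (R j).toSet}

/-- The dilate `t • R` of a rectangle: the same center, all the side lengths multiplied by `t`. -/
def DyadicRect.dilate {n : ℕ} (t : ℝ) (R : DyadicRect n) : Set (Fin n → ℝ) :=
  {x | ∀ j, x j ∈ Set.Ioo ((R j).center - t * (R j).length / 2)
    ((R j).center + t * (R j).length / 2)}

theorem DyadicRect.dilate_one {n : ℕ} (R : DyadicRect n) : R.dilate 1 = R.toSet := by
  ext x
  simp only [DyadicRect.dilate, DyadicRect.toSet, DyadicInterval.toSet, DyadicInterval.center,
    Set.mem_ofPred_eq]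
  refine forall_congr' fun j => ?_
  rw [show (((R j).2 : ℝ) + 1 / 2) * (R j).length - 1 * (R j).length / 2
      = ((R j).2 : ℝ) * (R j).length by ring,
    show (((R j).2 : ℝ) + 1 / 2) * (R j).length + 1 * (R j).length / 2
      = (((R j).2 : ℝ) + 1) * (R j).length by ring]

/-- The shadow of a collection of dyadic rectangles, the union of its members. -/
def shadow {n : ℕ} (U : Set (DyadicRect n)) : Set (Fin n → ℝ) :=
  ⋃ R ∈ U, DyadicRect.toSet R

/-- The wavelet `w_I (x) = |I| ^ (-1/2) * w ((x - c(I)) / |I|)`. -/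
def waveletOn (w : ℝ → ℂ) (I : DyadicInterval) (x : ℝ) : ℂ :=
  ((I.length ^ (-(1 / 2) : ℝ) : ℝ) : ℂ) * w ((x - I.center) / I.length)

/-- The product wavelet `v_R (x) = ∏ j, w_{R_j} (x_j)`. -/
def prodWavelet {n : ℕ} (w : ℝ → ℂ) (R : DyadicRect n) (x : Fin n → ℝ) : ℂ :=
  ∏ j, waveletOn w (R j) (x j)

/-- The function `w` is square integrable and the wavelets `w_I`, with `I` ranging over all the
dyadic intervals, form an orthonormal system in `L²(ℝ)`. -/
structure IsOrthonormalWavelet (w : ℝ → ℂ) : Prop where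
  memLp : MemLp w 2 volume
  norm_one : ∀ I : DyadicInterval,
    ∫ x, waveletOn w I x * (starRingEnd ℂ) (waveletOn w I x) = 1
  orthogonal : ∀ I J : DyadicInterval, I ≠ J →
    ∫ x, waveletOn w I x * (starRingEnd ℂ) (waveletOn w J x) = 0

/-- The wavelet coefficient `⟨f, v_R⟩`. -/
def waveletCoeff {n : ℕ} (w : ℝ → ℂ) (f : (Fin n → ℝ) → ℂ) (R : DyadicRect n) : ℂ :=
  ∫ x, f x * (starRingEnd ℂ) (prodWavelet w R x)

/-- All the wavelet coefficients of `f` are given by absolutely convergent integrals. -/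
def HasWaveletCoeffs {n : ℕ} (w : ℝ → ℂ) (f : (Fin n → ℝ) → ℂ) : Prop :=
  ∀ R : DyadicRect n, Integrable (fun x => f x * (starRingEnd ℂ) (prodWavelet w R x)) volume

/-- The product `BMO` norm of `f`: the supremum over the open sets `W` of finite measure of
`(|W|⁻¹ * ∑_{R ⊆ W} |⟨f, v_R⟩|²) ^ (1/2)`. -/
def bmoNorm {n : ℕ} (w : ℝ → ℂ) (f : (Fin n → ℝ) → ℂ) : ℝ≥0∞ :=
  ⨆ (W : Set (Fin n → ℝ)) (_ : IsOpen W) (_ : volume W < ⊤),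
    ((∑' R : {R : DyadicRect n // R.toSet ⊆ W}, ‖waveletCoeff w f R.1‖ₑ ^ 2)
      / volume W) ^ (1 / 2 : ℝ)

/-- A collection of rectangles has `n - 1` parameters: in some coordinate all of its members
have the same side. -/
def HasPredParameters {n : ℕ} (U : Set (DyadicRect n)) : Prop :=
  ∃ (k : Fin n) (I : DyadicInterval), ∀ R ∈ U, R k = I

/-- The `BMO_{-1}` norm of `b`: the supremum over the collections `U` with `n - 1` parameters and
a shadow of finite measure of `(|sh U|⁻¹ * ∑_{R ∈ U} |⟨b, v_R⟩|²) ^ (1/2)`. -/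
def bmoPredNorm {n : ℕ} (w : ℝ → ℂ) (b : (Fin n → ℝ) → ℂ) : ℝ≥0∞ :=
  ⨆ (U : Set (DyadicRect n)) (_ : HasPredParameters U) (_ : volume (shadow U) < ⊤),
    ((∑' R : U, ‖waveletCoeff w b R.1‖ₑ ^ 2) / volume (shadow U)) ^ (1 / 2 : ℝ)

/-- `f` is the sum of the functions `g i` in `L²(ℝⁿ)`, in the sense of unconditional
convergence. -/
def IsL2Sum {n : ℕ} {ι : Type*} (g : ι → (Fin n → ℝ) → ℂ) (f : (Fin n → ℝ) → ℂ) : Prop :=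
  MemLp f 2 volume ∧
    Tendsto (fun s : Finset ι => eLpNorm (fun x => f x - ∑ i ∈ s, g i x) 2 volume) atTop (𝓝 0)

end

/-! This is a form of Journé's lemma: the hypothesis controls rectangles sharing one side, and
rectangles that resist enlargement in a direction overlap little in that direction.

Filling. In one direction, take the `t`-dilates of all dyadic segments of which a set `E` misses a
proportion less than `s`; the maximal such segments show that the measure grows by at most the
factor `t / (1 - s)`. Done in every direction, this captures the `t`-dilate of each rectangle of
which `E` misses a proportion less than `s ^ n` (`dilate_subset_fill`). The set `V` is the `n`-th
iterate, started at the shadow. With `s = η` and `t = 1 + η` the total growth is at most `((1 + η) /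
(1 - η)) ^ (n * n)`, which is at most `1 + δ` for small `η`.

Classification. Raise all sides of `R ∈ U` by the same number of generations, and let `m + 1` be the
first number for which the `t`-dilate is not contained in `V`. Generation `m` gives `emb R ≥ 1 + η *
2 ^ m`. Raising the sides by `m + 1` generations one at a time, with one filling per side, must fail
at some side `k` (`exists_mem_edgeClass`): `R` lies in some `Q` with `Q k = R k`, inside the `k`-th
hull, whose extension in direction `k` misses that hull in a proportion at least `s ^ n`.

Packing. Fix `R k = I`. A fixed proportion of each `Q` consists of points whose fiber of the hull
contains, up to a null set, `I` but not its `(m + 1)`-st ancestor; so this edge set controls the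
shadow of the class. On a line such `I` overlap at most `m + 1` times, so the edge sets have total
measure at most `(m + 1)` times that of the hull. Applying the hypothesis for each `I`, a class sums
to `O((m + 1) * |sh U|)`, and the squared weights, `O(4 ^ (-m))`, make the sum over `m` converge
(`tsum_mul_le_of_hull`).

Testing the BMO norm on `W` restricts `U` to its members inside `W`. Hulls are monotone in the
collection, so embeddedness in `V` is at least that in the smaller hull, and the same estimate
applies. Orthonormality realizes the weighted coefficients by an `L²` function. -/

noncomputable section

/-! ### Dyadic intervals -/

namespace DyadicInterval

/-- The `p`-th dyadic ancestor of a dyadic interval. -/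
def ancestor (p : ℕ) (I : DyadicInterval) : DyadicInterval := (I.1 + p, I.2 / 2 ^ p)

/-- The open interval with the same center as `I` and `t` times its length. -/
def dilate (t : ℝ) (I : DyadicInterval) : Set ℝ :=
  Set.Ioo (I.center - t * I.length / 2) (I.center + t * I.length / 2)

theorem length_pos (I : DyadicInterval) : 0 < I.length := by
  unfold length; positivity

theorem length_ancestor (p : ℕ) (I : DyadicInterval) :
    (I.ancestor p).length = 2 ^ p * I.length := by
  simp only [length, ancestor]
  rw [zpow_add₀ (by norm_num), zpow_natCast, mul_comm]

theorem dilate_one (I : DyadicInterval) : I.dilate 1 = I.toSet := by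
  simp only [dilate, toSet, center]
  congr 1 <;> ring

theorem volume_dilate {t : ℝ} (ht : 0 ≤ t) (I : DyadicInterval) :
    volume (I.dilate t) = ENNReal.ofReal t * ENNReal.ofReal I.length := by
  rw [dilate, Real.volume_Ioo, ← ENNReal.ofReal_mul ht]
  congr 1; ring

theorem volume_toSet (I : DyadicInterval) : volume I.toSet = ENNReal.ofReal I.length := by
  rw [← dilate_one, volume_dilate zero_le_one]; simp

theorem volume_toSet_ne_zero (I : DyadicInterval) : volume I.toSet ≠ 0 := by
  rw [volume_toSet]; simpa using I.length_pos

theorem volume_toSet_ne_top (I : DyadicInterval) : volume I.toSet ≠ ⊤ := by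
  rw [volume_toSet]; simp

theorem measurableSet_toSet (I : DyadicInterval) : MeasurableSet I.toSet := measurableSet_Ioo

theorem volume_ancestor (p : ℕ) (I : DyadicInterval) :
    volume (I.ancestor p).toSet = 2 ^ p * volume I.toSet := by
  rw [volume_toSet, volume_toSet, length_ancestor, ENNReal.ofReal_mul (by positivity),
    ENNReal.ofReal_pow (by norm_num)]
  simp

theorem toSet_subset_dilate {t : ℝ} (ht : 1 ≤ t) (I : DyadicInterval) :
    I.toSet ⊆ I.dilate t := by
  rw [← dilate_one]
  have := I.length_pos
  exact Set.Ioo_subset_Ioo (by nlinarith) (by nlinarith)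

theorem ancestor_bounds (p : ℕ) (I : DyadicInterval) :
    ((I.ancestor p).2 : ℝ) * (I.ancestor p).length ≤ I.2 * I.length ∧
      ((I.2 : ℝ) + 1) * I.length ≤ ((I.ancestor p).2 + 1) * (I.ancestor p).length := by
  have hp : (0 : ℤ) < 2 ^ p := by positivity
  have h1 : I.2 / 2 ^ p * 2 ^ p ≤ I.2 := Int.ediv_mul_le _ hp.ne'
  have h2 : I.2 + 1 ≤ (I.2 / 2 ^ p + 1) * 2 ^ p := Int.lt_ediv_add_one_mul_self _ hp
  have h1' : ((I.2 / 2 ^ p : ℤ) : ℝ) * 2 ^ p ≤ I.2 := by exact_mod_cast h1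
  have h2' : (I.2 : ℝ) + 1 ≤ ((I.2 / 2 ^ p : ℤ) + 1 : ℝ) * 2 ^ p := by exact_mod_cast h2
  have hl := I.length_pos
  rw [length_ancestor]
  simp only [ancestor]
  constructor
  · calc _ = ((I.2 / 2 ^ p : ℤ) : ℝ) * 2 ^ p * I.length := by ring
      _ ≤ _ := by gcongr
  · calc _ ≤ ((I.2 / 2 ^ p : ℤ) + 1 : ℝ) * 2 ^ p * I.length := by gcongr
      _ = _ := by ring

theorem toSet_subset_ancestor (p : ℕ) (I : DyadicInterval) :
    I.toSet ⊆ (I.ancestor p).toSet :=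
  Set.Ioo_subset_Ioo (I.ancestor_bounds p).1 (I.ancestor_bounds p).2

/-- A dilate of `I` whose margin does not exceed that of the dilate of the ancestor. -/
theorem dilate_subset_dilate_ancestor {t u : ℝ} (p : ℕ) (I : DyadicInterval)
    (h : t - 1 ≤ (u - 1) * 2 ^ p) : I.dilate t ⊆ (I.ancestor p).dilate u := by
  obtain ⟨h1, h2⟩ := I.ancestor_bounds p
  have hl := I.length_pos
  have h3 : (t - 1) * I.length ≤ (u - 1) * (I.ancestor p).length := by
    rw [length_ancestor, ← mul_assoc]; gcongr
  refine Set.Ioo_subset_Ioo ?_ ?_ <;> simp only [center] <;> nlinarith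

theorem ancestor_zero (I : DyadicInterval) : I.ancestor 0 = I := by
  simp [ancestor]

/-- Two intersecting dyadic intervals are nested. -/
theorem eq_ancestor_of_mem {I J : DyadicInterval} {x : ℝ} (hI : x ∈ I.toSet) (hJ : x ∈ J.toSet)
    {p : ℕ} (hp : J.1 = I.1 + p) : J = I.ancestor p := by
  obtain ⟨hI1, hI2⟩ := hI
  obtain ⟨hJ1, hJ2⟩ := hJ
  have hl := I.length_pos
  have hJl : J.length = 2 ^ p * I.length := by
    rw [← length_ancestor]; simp [length, ancestor, hp]
  rw [hJl] at hJ1 hJ2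
  have h1 : (J.2 : ℝ) * 2 ^ p < I.2 + 1 := by
    refine lt_of_mul_lt_mul_right ?_ hl.le
    calc _ = (J.2 : ℝ) * (2 ^ p * I.length) := by ring
      _ < _ := hJ1.trans hI2
  have h2 : (I.2 : ℝ) < (J.2 + 1) * 2 ^ p := by
    refine lt_of_mul_lt_mul_right ?_ hl.le
    calc _ < _ := hI1.trans hJ2
      _ = _ := by ring
  have h1' : J.2 * 2 ^ p < I.2 + 1 := by exact_mod_cast h1
  have h2' : I.2 < (J.2 + 1) * 2 ^ p := by exact_mod_cast h2
  have hpos : (0 : ℤ) < 2 ^ p := by positivity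
  refine Prod.ext hp ?_
  refine le_antisymm ((Int.le_ediv_iff_mul_le hpos).2 (by omega)) ?_
  exact Int.lt_add_one_iff.1 ((Int.ediv_lt_iff_lt_mul hpos).2 h2')

theorem ancestor_subset_of_mem {I J : DyadicInterval} {x : ℝ} (hI : x ∈ I.toSet)
    (hJ : x ∈ J.toSet) {p : ℕ} (hp : I.1 + p ≤ J.1) : (I.ancestor p).toSet ⊆ J.toSet := by
  obtain ⟨q, hq⟩ := Int.le.dest hp
  rw [eq_ancestor_of_mem (I.toSet_subset_ancestor p hI) hJ (p := q) (by simp [ancestor, hq])]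
  exact toSet_subset_ancestor _ _

/-- Bounded lengths bound the scales, which guarantees maximal filled intervals in a set of finite
measure. -/
theorem exists_length_lt (C : ℝ) : ∃ N : ℤ, ∀ J : DyadicInterval, J.length ≤ C → J.1 < N := by
  obtain ⟨N, hN⟩ := pow_unbounded_of_one_lt C (one_lt_two)
  refine ⟨N, fun J hJ => ?_⟩
  have : (2 : ℝ) ^ J.1 < 2 ^ (N : ℤ) := by
    rw [zpow_natCast]; exact hJ.trans_lt hN
  exact (zpow_lt_zpow_iff_right₀ one_lt_two).1 this

/-- The set `A` fills the dyadic interval `J` up to a proportion less than `s`. -/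
def IsFilled (s : ℝ≥0∞) (A : Set ℝ) (J : DyadicInterval) : Prop :=
  volume (J.toSet \ A) < s * volume J.toSet

theorem IsFilled.mono {s : ℝ≥0∞} {A B : Set ℝ} (h : A ⊆ B) {J : DyadicInterval}
    (hJ : J.IsFilled s A) : J.IsFilled s B :=
  (measure_mono (Set.sdiff_subset_sdiff_right h)).trans_lt hJ

theorem IsFilled.le_volume_inter {s : ℝ≥0∞} {A : Set ℝ} (hA : MeasurableSet A)
    {J : DyadicInterval} (hJ : J.IsFilled s A) :
    (1 - s) * volume J.toSet ≤ volume (J.toSet ∩ A) := by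
  have h := measure_inter_add_sdiff (μ := volume) J.toSet hA
  rw [ENNReal.sub_mul (fun _ _ => J.volume_toSet_ne_top), one_mul, tsub_le_iff_right, ← h]
  gcongr
  exact (hJ.trans_eq (by rw [h])).le

/-- The union of the dilates of the dyadic intervals mostly filled by `A` is not much larger
than `A`. -/
theorem volume_iUnion_dilate_le {s : ℝ≥0∞} (hs : s < 1) {t : ℝ} (ht : 1 ≤ t) {A : Set ℝ}
    (hA : MeasurableSet A) :
    volume (⋃ (J : DyadicInterval) (_ : J.IsFilled s A), J.dilate t) ≤
      ENNReal.ofReal t / (1 - s) * volume A := by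
  have hs0 : 1 - s ≠ 0 := (tsub_pos_of_lt hs).ne'
  have hs1 : 1 - s ≠ ⊤ := (tsub_le_self.trans_lt ENNReal.one_lt_top).ne
  have ht0 : 0 ≤ t := zero_le_one.trans ht
  rcases eq_or_ne (volume A) ⊤ with hA' | hA'
  · rw [hA', ENNReal.mul_top]
    · exact le_top
    · exact (ENNReal.div_pos (by simpa using zero_lt_one.trans_le ht) hs1).ne'
  have hdiv : ∀ {J : DyadicInterval}, J.IsFilled s A →
      volume J.toSet ≤ volume (J.toSet ∩ A) / (1 - s) := fun {J} hJ => by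
    rw [ENNReal.le_div_iff_mul_le (Or.inl hs0) (Or.inl hs1), mul_comm]
    exact hJ.le_volume_inter hA
  obtain ⟨N, hN⟩ := exists_length_lt (volume A / (1 - s)).toReal
  have hN' : ∀ J : DyadicInterval, J.IsFilled s A → J.1 < N := fun J hJ => by
    refine hN J ?_
    rw [← ENNReal.ofReal_le_iff_le_toReal (ENNReal.div_ne_top hA' hs0), ← volume_toSet]
    exact (hdiv hJ).trans (by gcongr; exact Set.inter_subset_right)
  -- The maximal filled intervals are pairwise disjoint; the bound `N` on the scales makes the
  -- ascent to them terminate.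
  let X : Set DyadicInterval := {J | J.IsFilled s A ∧ ∀ p : ℕ, 1 ≤ p → ¬(J.ancestor p).IsFilled s A}
  have hsub : (⋃ (J : DyadicInterval) (_ : J.IsFilled s A), J.dilate t) ⊆ ⋃ J ∈ X, J.dilate t := by
    refine Set.iUnion₂_subset fun J hJ => ?_
    suffices h : ∀ d : ℕ, ∀ J : DyadicInterval, J.IsFilled s A → N ≤ J.1 + d →
        ∃ J' ∈ X, J.dilate t ⊆ J'.dilate t by
      obtain ⟨J', hJ', hsub⟩ := h (N - J.1).toNat J hJ (by omega)
      exact hsub.trans (Set.subset_biUnion_of_mem (u := fun J : DyadicInterval => J.dilate t) hJ')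
    intro d
    induction d using Nat.strong_induction_on with
    | _ d ih =>
      intro J hJ hd
      by_cases hX : J ∈ X
      · exact ⟨J, hX, subset_rfl⟩
      · have : ∃ p : ℕ, 1 ≤ p ∧ (J.ancestor p).IsFilled s A := by
          by_contra! hcon
          exact hX ⟨hJ, hcon⟩
        obtain ⟨p, hp1, hp⟩ := this
        have hlt := hN' _ hp
        have hlev : (J.ancestor p).1 = J.1 + p := rfl
        have hpd : p < d := by omega
        obtain ⟨J', hJ', hsub⟩ := ih (d - p) (by omega) (J.ancestor p) hp (by omega)
        refine ⟨J', hJ', Set.Subset.trans (dilate_subset_dilate_ancestor p J ?_) hsub⟩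
        have : (1 : ℝ) ≤ 2 ^ p := one_le_pow₀ one_le_two
        nlinarith
  have hdisj : X.PairwiseDisjoint fun J => J.toSet ∩ A := by
    have key : ∀ I ∈ X, ∀ J ∈ X, ∀ x, x ∈ I.toSet → x ∈ J.toSet → I.1 ≤ J.1 → I = J := by
      intro I hI J hJ x hxI hxJ hle
      obtain ⟨p, hp⟩ := Int.le.dest hle
      have := eq_ancestor_of_mem hxI hxJ hp.symm
      rcases Nat.eq_zero_or_pos p with rfl | hp0
      · rw [this, ancestor_zero]
      · exact absurd (this ▸ hJ.1) (hI.2 p hp0)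
    intro I hI J hJ hne
    refine Set.disjoint_left.2 fun x hxI hxJ => hne ?_
    rcases le_total I.1 J.1 with h | h
    · exact key I hI J hJ x hxI.1 hxJ.1 h
    · exact (key J hJ I hI x hxJ.1 hxI.1 h).symm
  calc _ ≤ volume (⋃ J ∈ X, J.dilate t) := measure_mono hsub
    _ ≤ ∑' J : X, volume (J.1.dilate t) := measure_biUnion_le _ X.to_countable _
    _ ≤ ∑' J : X, ENNReal.ofReal t / (1 - s) * volume (J.1.toSet ∩ A) := by
        refine ENNReal.tsum_le_tsum fun J => ?_
        rw [volume_dilate ht0, ← volume_toSet, div_eq_mul_inv, mul_assoc, mul_comm (1 - s)⁻¹,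
          ← div_eq_mul_inv]
        gcongr
        exact hdiv J.2.1
    _ = ENNReal.ofReal t / (1 - s) * volume (⋃ J ∈ X, J.toSet ∩ A) := by
        rw [ENNReal.tsum_mul_left, measure_biUnion X.to_countable hdisj
          fun J _ => J.measurableSet_toSet.inter hA]
    _ ≤ _ := by
        gcongr
        exact Set.iUnion₂_subset fun J _ => Set.inter_subset_right

/-- The dyadic intervals contained in `A` up to a null set while their `M`-th ancestors are not:
they overlap at most `M` times. -/
theorem tsum_volume_le_of_ancestor {A : Set ℝ} (hA : MeasurableSet A) {M : ℕ} (hM : 1 ≤ M) :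
    ∑' I : {I : DyadicInterval // volume (I.toSet \ A) = 0 ∧
      volume ((I.ancestor M).toSet \ A) ≠ 0}, volume I.1.toSet ≤ M * volume A := by
  set X : Set DyadicInterval := {I | volume (I.toSet \ A) = 0 ∧
    volume ((I.ancestor M).toSet \ A) ≠ 0} with hX
  have hM' : (M : ℤ) ≠ 0 := by omega
  -- Scales are split modulo `M`. If `I` lies strictly inside `J` in the same residue class, then
  -- `J` contains the `M`-th ancestor of `I`, which is impossible; so each class is disjoint.
  let X' : ℕ → Set DyadicInterval := fun r => {I ∈ X | I.1 % M = r}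
  have hdisj : ∀ r, (X' r).PairwiseDisjoint fun J => J.toSet ∩ A := by
    intro r
    have key : ∀ I ∈ X' r, ∀ J ∈ X' r, ∀ x, x ∈ I.toSet → x ∈ J.toSet → I.1 ≤ J.1 → I = J := by
      intro I hI J hJ x hxI hxJ hle
      rcases hle.eq_or_lt with h | h
      · rw [eq_ancestor_of_mem hxI hxJ (p := 0) (by simp [h]), ancestor_zero]
      · have hdvd : (M : ℤ) ∣ J.1 - I.1 :=
          Int.dvd_of_emod_eq_zero (Int.emod_eq_emod_iff_emod_sub_eq_zero.1 (hJ.2.trans hI.2.symm))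
        have hge : (M : ℤ) ≤ J.1 - I.1 := Int.le_of_dvd (by omega) hdvd
        have hsub := ancestor_subset_of_mem hxI hxJ (p := M) (by omega)
        exact absurd (measure_mono_null (Set.sdiff_subset_sdiff_left hsub) hJ.1.1) hI.1.2
    intro I hI J hJ hne
    refine Set.disjoint_left.2 fun x hxI hxJ => hne ?_
    rcases le_total I.1 J.1 with h | h
    · exact key I hI J hJ x hxI.1 hxJ.1 h
    · exact (key J hJ I hI x hxJ.1 hxI.1 h).symm
  have hpart : ∀ I ∈ X, volume I.toSet = volume (I.toSet ∩ A) := fun I hI => by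
    rw [← measure_inter_add_sdiff I.toSet hA, hI.1, add_zero]
  have hone : ∀ r, ∑' I : X' r, volume I.1.toSet ≤ volume A := fun r => by
    calc _ = ∑' I : X' r, volume (I.1.toSet ∩ A) := tsum_congr fun I => hpart I.1 I.2.1
      _ = volume (⋃ I ∈ X' r, I.toSet ∩ A) := by
        rw [measure_biUnion (X' r).to_countable (hdisj r)
          fun J _ => J.measurableSet_toSet.inter hA]
      _ ≤ _ := measure_mono (Set.iUnion₂_subset fun J _ => Set.inter_subset_right)
  have hcov : X ⊆ ⋃ r ∈ Finset.range M, X' r := fun I hI => by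
    have h0 := Int.emod_nonneg I.1 hM'
    have h1 := Int.emod_lt_of_pos I.1 (b := M) (by omega)
    simp only [Set.mem_iUnion, Finset.mem_range]
    exact ⟨(I.1 % M).toNat, by omega, hI, by omega⟩
  calc ∑' I : X, volume I.1.toSet
      ≤ ∑' I : ↑(⋃ r ∈ Finset.range M, X' r), volume I.1.toSet :=
        ENNReal.tsum_mono_subtype (fun I : DyadicInterval => volume I.toSet) hcov
    _ ≤ ∑ r ∈ Finset.range M, ∑' I : X' r, volume I.1.toSet :=
        ENNReal.tsum_biUnion_le (fun I : DyadicInterval => volume I.toSet) _ _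
    _ ≤ ∑ r ∈ Finset.range M, volume A := Finset.sum_le_sum fun r _ => hone r
    _ = M * volume A := by simp

end DyadicInterval

/-! ### Fibers in one coordinate direction -/

/-- The fiber of `E` through `x` in the direction of the coordinate `k`. -/
def fiber {n : ℕ} (k : Fin n) (E : Set (Fin n → ℝ)) (x : Fin n → ℝ) : Set ℝ :=
  {r | Function.update x k r ∈ E}

section Fiber

variable {n : ℕ} {k : Fin n} {E F : Set (Fin n → ℝ)}

theorem measurableSet_fiber (hE : MeasurableSet E) (x : Fin n → ℝ) :
    MeasurableSet (fiber k E x) :=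
  (measurable_update x (a := k)) hE

theorem fiber_update (x : Fin n → ℝ) (r : ℝ) :
    fiber k E (Function.update x k r) = fiber k E x := by
  simp [fiber]

theorem measurable_volume_diff_fiber (hE : MeasurableSet E) (S : Set ℝ) (hS : MeasurableSet S) :
    Measurable fun x => volume (S \ fiber k E x) := by
  have hm : MeasurableSet {p : (Fin n → ℝ) × ℝ | p.2 ∈ S ∧ Function.update p.1 k p.2 ∉ E} :=
    (measurable_snd hS).inter ((measurable_update' (a := k)) hE).compl
  exact measurable_measure_prodMk_left hm

/-- Tonelli in a single coordinate; marginals avoid splitting `ℝⁿ` into a product. -/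
theorem lintegral_le_of_lintegral_update_le {f g : (Fin n → ℝ) → ℝ≥0∞} (k : Fin n)
    (hf : Measurable f) (hg : Measurable g)
    (h : ∀ x, ∫⁻ r, f (Function.update x k r) ≤ ∫⁻ r, g (Function.update x k r)) :
    ∫⁻ x, f x ≤ ∫⁻ x, g x := by
  refine lintegral_le_of_lmarginal_le (μ := fun _ : Fin n => (volume : Measure ℝ)) {k} hf hg ?_
  intro x
  simpa only [lmarginal_singleton] using h x

theorem lintegral_indicator_update (hE : MeasurableSet E) (x : Fin n → ℝ) :
    ∫⁻ r, E.indicator (1 : (Fin n → ℝ) → ℝ≥0∞) (Function.update x k r) =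
      volume (fiber k E x) := by
  rw [← lintegral_indicator_one (measurableSet_fiber hE x)]
  rfl

theorem volume_le_of_fiber_le (k : Fin n) (hE : MeasurableSet E) (hF : MeasurableSet F)
    {c : ℝ≥0∞} (h : ∀ x, volume (fiber k E x) ≤ c * volume (fiber k F x)) :
    volume E ≤ c * volume F := by
  have h1 : Measurable (F.indicator (1 : (Fin n → ℝ) → ℝ≥0∞)) := measurable_one.indicator hF
  rw [← lintegral_indicator_one hE, ← lintegral_indicator_one hF, ← lintegral_const_mul c h1]
  refine lintegral_le_of_lintegral_update_le k (measurable_one.indicator hE) (h1.const_mul c) ?_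
  intro x
  have h2 : Measurable fun r => F.indicator (1 : (Fin n → ℝ) → ℝ≥0∞) (Function.update x k r) :=
    h1.comp (measurable_update x)
  rw [lintegral_const_mul c h2, lintegral_indicator_update hE, lintegral_indicator_update hF]
  exact h x

end Fiber

/-! ### Filling in the coordinate directions -/

namespace DyadicRect

variable {n : ℕ}

theorem toSet_eq_pi (R : DyadicRect n) : R.toSet = Set.univ.pi fun j => (R j).toSet := by
  ext x; simp [toSet]

theorem mem_dilate {t : ℝ} {R : DyadicRect n} {x : Fin n → ℝ} :
    x ∈ R.dilate t ↔ ∀ j, x j ∈ (R j).dilate t := Iff.rfl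

theorem volume_toSet (R : DyadicRect n) : volume R.toSet = ∏ j, volume (R j).toSet := by
  rw [toSet_eq_pi, volume_pi_pi]

theorem volume_dilate {t : ℝ} (ht : 0 ≤ t) (R : DyadicRect n) :
    volume (R.dilate t) = ENNReal.ofReal t ^ n * volume R.toSet := by
  have : R.dilate t = Set.univ.pi fun j => (R j).dilate t := by
    ext x; simp [mem_dilate]
  rw [this, volume_pi_pi, volume_toSet]
  simp_rw [DyadicInterval.volume_dilate ht, ← DyadicInterval.volume_toSet]
  simp [Finset.prod_mul_distrib]

theorem isOpen_dilate (t : ℝ) (R : DyadicRect n) : IsOpen (R.dilate t) := by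
  have : R.dilate t = Set.univ.pi fun j => (R j).dilate t := by
    ext x; simp [mem_dilate]
  rw [this]
  exact isOpen_set_pi Set.finite_univ fun j _ => isOpen_Ioo

theorem isOpen_toSet (R : DyadicRect n) : IsOpen R.toSet := by
  rw [← dilate_one]; exact isOpen_dilate 1 R

theorem measurableSet_toSet (R : DyadicRect n) : MeasurableSet R.toSet :=
  R.isOpen_toSet.measurableSet

theorem volume_toSet_ne_zero (R : DyadicRect n) : volume R.toSet ≠ 0 := by
  rw [volume_toSet]
  exact Finset.prod_ne_zero_iff.2 fun j _ => (R j).volume_toSet_ne_zero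

theorem volume_toSet_ne_top (R : DyadicRect n) : volume R.toSet ≠ ⊤ := by
  rw [volume_toSet]
  exact ENNReal.prod_ne_top fun j _ => (R j).volume_toSet_ne_top

theorem toSet_subset_dilate {t : ℝ} (ht : 1 ≤ t) (R : DyadicRect n) : R.toSet ⊆ R.dilate t :=
  fun _ hx j => (R j).toSet_subset_dilate ht (hx j)

end DyadicRect

/-- The union of the dilates of the segments in the direction `k`, with dyadic projection, that
are mostly filled by `E`. -/
def expand {n : ℕ} (s : ℝ≥0∞) (t : ℝ) (k : Fin n) (E : Set (Fin n → ℝ)) : Set (Fin n → ℝ) :=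
  ⋃ J : DyadicInterval, {x | x k ∈ J.dilate t ∧ J.IsFilled s (fiber k E x)}

/-- The result of successive expansions in all the coordinate directions. -/
def fill {n : ℕ} (s : ℝ≥0∞) (t : ℝ) (E : Set (Fin n → ℝ)) : Set (Fin n → ℝ) :=
  (List.finRange n).foldr (expand s t) E

section Fill

variable {n : ℕ} {s : ℝ≥0∞} {t : ℝ}

theorem measurableSet_expand (k : Fin n) {E : Set (Fin n → ℝ)} (hE : MeasurableSet E) :
    MeasurableSet (expand s t k E) := by
  refine MeasurableSet.iUnion fun J => ?_
  have hk : Measurable fun x : Fin n → ℝ => x k := measurable_pi_apply k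
  refine (hk (measurableSet_Ioo : MeasurableSet (J.dilate t))).inter ?_
  exact measurableSet_lt (measurable_volume_diff_fiber hE _ J.measurableSet_toSet)
    measurable_const

theorem expand_mono (k : Fin n) {E F : Set (Fin n → ℝ)} (h : E ⊆ F) :
    expand s t k E ⊆ expand s t k F :=
  Set.iUnion_mono fun _ _ hx => ⟨hx.1, hx.2.mono fun _ hr => h hr⟩

theorem volume_expand_le (hs : s < 1) (ht : 1 ≤ t) (k : Fin n) {E : Set (Fin n → ℝ)}
    (hE : MeasurableSet E) :
    volume (expand s t k E) ≤ ENNReal.ofReal t / (1 - s) * volume E := by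
  refine volume_le_of_fiber_le k (measurableSet_expand k hE) hE fun x => ?_
  refine le_trans (measure_mono ?_)
    (DyadicInterval.volume_iUnion_dilate_le hs ht (measurableSet_fiber hE x))
  intro r hr
  obtain ⟨J, hJ1, hJ2⟩ := Set.mem_iUnion.1 hr
  rw [fiber_update] at hJ2
  simp only [Function.update_self] at hJ1
  exact Set.mem_iUnion₂.2 ⟨J, hJ2, hJ1⟩

theorem measurableSet_foldr_expand (L : List (Fin n)) {E : Set (Fin n → ℝ)}
    (hE : MeasurableSet E) : MeasurableSet (L.foldr (expand s t) E) := by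
  induction L with
  | nil => exact hE
  | cons k L ih => exact measurableSet_expand k ih

theorem measurableSet_fill {E : Set (Fin n → ℝ)} (hE : MeasurableSet E) :
    MeasurableSet (fill s t E) :=
  measurableSet_foldr_expand _ hE

theorem fill_mono {E F : Set (Fin n → ℝ)} (h : E ⊆ F) : fill s t E ⊆ fill s t F := by
  unfold fill
  induction List.finRange n with
  | nil => exact h
  | cons k L ih => exact expand_mono k ih

theorem volume_fill_le (hs : s < 1) (ht : 1 ≤ t) {E : Set (Fin n → ℝ)} (hE : MeasurableSet E) :
    volume (fill s t E) ≤ (ENNReal.ofReal t / (1 - s)) ^ n * volume E := by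
  suffices h : ∀ L : List (Fin n), volume (L.foldr (expand s t) E) ≤
      (ENNReal.ofReal t / (1 - s)) ^ L.length * volume E by
    simpa [fill] using h (List.finRange n)
  intro L
  induction L with
  | nil => simp
  | cons k L ih =>
    refine (volume_expand_le hs ht k (measurableSet_foldr_expand L hE)).trans ?_
    rw [List.length_cons, pow_succ', mul_assoc]
    gcongr

/-- Each expansion that misses `z` leaves, in its direction, at least a proportion `s` of the side
of `R` outside the previous set. Replacing that coordinate by these points and recursing multiplies
the proportions. -/
theorem le_lmarginal_of_notMem_foldr_expand {E : Set (Fin n → ℝ)} (hE : MeasurableSet E)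
    (R : DyadicRect n) (L : List (Fin n)) (hL : L.Nodup) (z : Fin n → ℝ)
    (hz : z ∉ L.foldr (expand s t) E) (hzL : ∀ j ∈ L, z j ∈ (R j).dilate t)
    (hzR : ∀ j ∉ L, z j ∈ (R j).toSet) :
    s ^ L.length * ∏ j ∈ L.toFinset, volume (R j).toSet ≤
      lmarginal (fun _ => volume) L.toFinset
        ((R.toSet \ E).indicator (1 : (Fin n → ℝ) → ℝ≥0∞)) z := by
  have hm : Measurable ((R.toSet \ E).indicator (1 : (Fin n → ℝ) → ℝ≥0∞)) :=
    measurable_one.indicator (R.measurableSet_toSet.diff hE)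
  induction L generalizing z with
  | nil =>
    have : z ∈ R.toSet \ E := ⟨fun j => hzR j List.not_mem_nil, hz⟩
    simp [this]
  | cons k L ih =>
    obtain ⟨hkL, hL'⟩ := List.nodup_cons.1 hL
    have hkL' : k ∉ L.toFinset := by simpa using hkL
    set F := L.foldr (expand s t) E with hF
    have hFm : MeasurableSet F := measurableSet_foldr_expand L hE
    -- Since `z k` lies in the dilate of `R k`, only insufficient filling of `R k` can keep `z` out
    -- of the expansion.
    have hbad : s * volume (R k).toSet ≤ volume ((R k).toSet \ fiber k F z) := by
      by_contra! hcon
      exact hz (Set.mem_iUnion.2 ⟨R k, hzL k (by simp), hcon⟩)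
    rw [List.toFinset_cons, lmarginal_insert _ hm hkL', Finset.prod_insert hkL', List.length_cons]
    calc _ = (s ^ L.length * ∏ j ∈ L.toFinset, volume (R j).toSet) *
          (s * volume (R k).toSet) := by ring
      _ ≤ (s ^ L.length * ∏ j ∈ L.toFinset, volume (R j).toSet) *
          volume ((R k).toSet \ fiber k F z) := by gcongr
      _ = ∫⁻ _ in (R k).toSet \ fiber k F z,
          (s ^ L.length * ∏ j ∈ L.toFinset, volume (R j).toSet) := by
          rw [setLIntegral_const]
      _ ≤ ∫⁻ r in (R k).toSet \ fiber k F z, lmarginal (fun _ => volume) L.toFinset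
          ((R.toSet \ E).indicator (1 : (Fin n → ℝ) → ℝ≥0∞)) (Function.update z k r) := by
          refine setLIntegral_mono' ((R k).measurableSet_toSet.diff (measurableSet_fiber hFm z)) ?_
          intro r hr
          refine ih hL' _ hr.2 (fun j hj => ?_) (fun j hj => ?_)
          · have hjk : j ≠ k := fun h => hkL (h ▸ hj)
            rw [Function.update_of_ne hjk]
            exact hzL j (List.mem_cons_of_mem _ hj)
          · rcases eq_or_ne j k with rfl | hjk
            · simpa using hr.1
            · rw [Function.update_of_ne hjk]
              exact hzR j (by simp [hjk, hj])
      _ ≤ _ := setLIntegral_le_lintegral _ _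

/-- The filling of `E` contains the dilates of the dyadic rectangles mostly filled by `E`. -/
theorem dilate_subset_fill {E : Set (Fin n → ℝ)} (hE : MeasurableSet E) {R : DyadicRect n}
    (h : volume (R.toSet \ E) < s ^ n * volume R.toSet) : R.dilate t ⊆ fill s t E := by
  intro z hz
  by_contra hcon
  have := le_lmarginal_of_notMem_foldr_expand hE R (List.finRange n) (List.nodup_finRange n) z hcon
    (fun j _ => hz j) (fun j hj => absurd (List.mem_finRange j) hj)
  rw [List.toFinset_finRange, lmarginal_univ, List.length_finRange,
    ← DyadicRect.volume_toSet] at this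
  refine absurd h (not_lt.2 (this.trans_eq ?_))
  exact lintegral_indicator_one (R.measurableSet_toSet.diff hE)

end Fill

/-! ### Carleson packing in one coordinate direction -/

/-- The points whose fiber in the direction `k` is, up to a null set, contained in `A` over the
dyadic interval `I`, but not over its `M`-th ancestor. -/
def edgeSet {n : ℕ} (k : Fin n) (M : ℕ) (A : Set (Fin n → ℝ)) (I : DyadicInterval) :
    Set (Fin n → ℝ) :=
  {x | x k ∈ I.toSet ∧ volume (I.toSet \ fiber k A x) = 0 ∧
    volume ((I.ancestor M).toSet \ fiber k A x) ≠ 0}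

section EdgeSet

variable {n : ℕ} {k : Fin n} {M : ℕ} {A : Set (Fin n → ℝ)}

theorem measurableSet_edgeSet (hA : MeasurableSet A) (I : DyadicInterval) :
    MeasurableSet (edgeSet k M A I) := by
  have hk : Measurable fun x : Fin n → ℝ => x k := measurable_pi_apply k
  refine (hk I.measurableSet_toSet).inter (MeasurableSet.inter ?_ ?_)
  · exact (measurable_volume_diff_fiber hA _ I.measurableSet_toSet) (measurableSet_singleton 0)
  · exact (measurable_volume_diff_fiber hA _ (I.ancestor M).measurableSet_toSet)
      (measurableSet_singleton 0).compl

/-- On each line in direction `k` this is the bounded overlap of `tsum_volume_le_of_ancestor`. -/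
theorem tsum_volume_edgeSet_le (hA : MeasurableSet A) (hM : 1 ≤ M) :
    ∑' I, volume (edgeSet k M A I) ≤ M * volume A := by
  have hmI : ∀ I, Measurable ((edgeSet k M A I).indicator (1 : (Fin n → ℝ) → ℝ≥0∞)) :=
    fun I => measurable_one.indicator (measurableSet_edgeSet hA I)
  have hmA : Measurable (A.indicator (1 : (Fin n → ℝ) → ℝ≥0∞)) := measurable_one.indicator hA
  simp_rw [← lintegral_indicator_one hA, ← lintegral_indicator_one (measurableSet_edgeSet hA _)]
  rw [← lintegral_tsum fun I => (hmI I).aemeasurable, ← lintegral_const_mul _ hmA]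
  refine lintegral_le_of_lintegral_update_le k (Measurable.tsum hmI) (hmA.const_mul _) ?_
  intro x
  have hmI' : ∀ I, Measurable fun r =>
      (edgeSet k M A I).indicator (1 : (Fin n → ℝ) → ℝ≥0∞) (Function.update x k r) :=
    fun I => (hmI I).comp (measurable_update x)
  have hmA' : Measurable fun r =>
      A.indicator (1 : (Fin n → ℝ) → ℝ≥0∞) (Function.update x k r) :=
    hmA.comp (measurable_update x)
  rw [lintegral_tsum fun I => (hmI' I).aemeasurable, lintegral_const_mul _ hmA',
    lintegral_indicator_update hA]
  refine le_trans ?_ (DyadicInterval.tsum_volume_le_of_ancestor (measurableSet_fiber hA x) hM)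
  refine le_trans ?_ (tsum_subtype {I : DyadicInterval | volume (I.toSet \ fiber k A x) = 0 ∧
    volume ((I.ancestor M).toSet \ fiber k A x) ≠ 0} fun I => volume I.toSet).ge
  refine ENNReal.tsum_le_tsum fun I => ?_
  rw [lintegral_indicator_update (measurableSet_edgeSet hA I)]
  by_cases h : volume (I.toSet \ fiber k A x) = 0 ∧
      volume ((I.ancestor M).toSet \ fiber k A x) ≠ 0
  · rw [Set.indicator_of_mem (by exact h)]
    refine measure_mono fun r hr => ?_
    simpa using hr.1
  · rw [Set.indicator_of_notMem (by exact h)]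
    refine (measure_mono_null (t := ∅) (fun r hr => h ?_) measure_empty).le
    have := hr.2
    rwa [fiber_update] at this

/-- If `Q` lies in `A` and a proportion of its expansion in the direction `k` is outside of `A`,
then the edge set of `A` takes up the same proportion of `Q`. -/
theorem le_volume_inter_edgeSet (hA : MeasurableSet A) {Q : DyadicRect n} (hQ : Q.toSet ⊆ A)
    {θ : ℝ≥0∞}
    (hθ : θ * volume (DyadicRect.toSet (Function.update Q k ((Q k).ancestor M))) ≤
      volume (DyadicRect.toSet (Function.update Q k ((Q k).ancestor M)) \ A)) :
    θ * volume Q.toSet ≤ volume (Q.toSet ∩ edgeSet k M A (Q k)) := by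
  set P : DyadicRect n := Function.update Q k ((Q k).ancestor M) with hP
  have hvol : volume P.toSet = 2 ^ M * volume Q.toSet := by
    rw [DyadicRect.volume_toSet, DyadicRect.volume_toSet,
      ← Finset.mul_prod_erase _ (fun j => volume (P j).toSet) (Finset.mem_univ k),
      ← Finset.mul_prod_erase _ (fun j => volume (Q j).toSet) (Finset.mem_univ k), hP,
      Function.update_self, DyadicInterval.volume_ancestor, mul_assoc]
    congr 2
    exact Finset.prod_congr rfl fun j hj => by rw [Function.update_of_ne (Finset.ne_of_mem_erase hj)]
  have hmP : MeasurableSet (P.toSet \ A) := P.measurableSet_toSet.diff hA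
  have hmQ : MeasurableSet (Q.toSet ∩ edgeSet k M A (Q k)) :=
    Q.measurableSet_toSet.inter (measurableSet_edgeSet hA _)
  -- If a line meets `P \ A` in positive measure, the part of it over `Q k` lies entirely in the
  -- edge set, and the part over the ancestor is only `2 ^ M` times longer.
  have key : volume (P.toSet \ A) ≤ 2 ^ M * volume (Q.toSet ∩ edgeSet k M A (Q k)) := by
    refine volume_le_of_fiber_le k hmP hmQ fun x => ?_
    have hsub : fiber k (P.toSet \ A) x ⊆ ((Q k).ancestor M).toSet \ fiber k A x := fun r hr => by
      refine ⟨?_, hr.2⟩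
      simpa [hP] using hr.1 k
    by_cases h0 : volume (fiber k (P.toSet \ A) x) = 0
    · rw [h0]; exact zero_le
    obtain ⟨r₀, hr₀⟩ := nonempty_of_measure_ne_zero h0
    have hx : ∀ j, j ≠ k → x j ∈ (Q j).toSet := fun j hj => by
      simpa [hP, hj] using hr₀.1 j
    have hQx : ∀ r ∈ (Q k).toSet, Function.update x k r ∈ Q.toSet := fun r hr j => by
      rcases eq_or_ne j k with rfl | hj
      · simpa using hr
      · simpa [hj] using hx j hj
    have h1 : volume ((Q k).toSet \ fiber k A x) = 0 :=
      measure_mono_null (t := ∅) (fun r hr => hr.2 (hQ (hQx r hr.1))) measure_empty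
    have h2 : volume (((Q k).ancestor M).toSet \ fiber k A x) ≠ 0 := fun h =>
      h0 (measure_mono_null hsub h)
    calc _ ≤ volume ((Q k).ancestor M).toSet := measure_mono (hsub.trans Set.sdiff_subset)
      _ = 2 ^ M * volume (Q k).toSet := DyadicInterval.volume_ancestor _ _
      _ ≤ _ := by
        gcongr
        intro r hr
        refine ⟨hQx r hr, ?_, ?_⟩
        · simpa using hr
        · rw [fiber_update]; exact ⟨h1, h2⟩
  have h2M : (2 : ℝ≥0∞) ^ M ≠ 0 := by positivity
  have h2M' : (2 : ℝ≥0∞) ^ M ≠ ⊤ := ENNReal.pow_ne_top (by simp)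
  refine (ENNReal.mul_le_mul_iff_right h2M h2M').1 ?_
  calc _ = θ * volume P.toSet := by rw [hvol]; ring
    _ ≤ _ := hθ.trans key

end EdgeSet

/-! ### Journé's lemma -/

section Hull

variable {n : ℕ} {s : ℝ≥0∞} {t : ℝ}

theorem isOpen_shadow (U : Set (DyadicRect n)) : IsOpen (shadow U) :=
  isOpen_biUnion fun R _ => R.isOpen_toSet

theorem shadow_mono {U U' : Set (DyadicRect n)} (h : U ⊆ U') : shadow U ⊆ shadow U' :=
  Set.biUnion_subset_biUnion_left h

theorem toSet_subset_shadow {U : Set (DyadicRect n)} {R : DyadicRect n} (hR : R ∈ U) :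
    R.toSet ⊆ shadow U :=
  Set.subset_biUnion_of_mem (u := DyadicRect.toSet) hR

/-- The `i`-fold iterated filling of the shadow of a collection of dyadic rectangles. -/
def hull (s : ℝ≥0∞) (t : ℝ) (U : Set (DyadicRect n)) (i : ℕ) : Set (Fin n → ℝ) :=
  (fill s t)^[i] (shadow U)

theorem hull_zero (U : Set (DyadicRect n)) : hull s t U 0 = shadow U := rfl

theorem hull_succ (U : Set (DyadicRect n)) (i : ℕ) :
    hull s t U (i + 1) = fill s t (hull s t U i) :=
  Function.iterate_succ_apply' _ _ _

theorem measurableSet_hull (U : Set (DyadicRect n)) (i : ℕ) : MeasurableSet (hull s t U i) := by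
  induction i with
  | zero => exact (isOpen_shadow U).measurableSet
  | succ i ih => rw [hull_succ]; exact measurableSet_fill ih

theorem hull_mono {U U' : Set (DyadicRect n)} (h : U ⊆ U') (i : ℕ) :
    hull s t U i ⊆ hull s t U' i := by
  induction i with
  | zero => exact shadow_mono h
  | succ i ih => rw [hull_succ, hull_succ]; exact fill_mono ih

theorem volume_hull_le (hs : s < 1) (ht : 1 ≤ t) (U : Set (DyadicRect n)) {i : ℕ} (hi : i ≤ n) :
    volume (hull s t U i) ≤ (ENNReal.ofReal t / (1 - s)) ^ (n * n) * volume (shadow U) := by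
  have h : ∀ i, volume (hull s t U i) ≤
      (ENNReal.ofReal t / (1 - s)) ^ (n * i) * volume (shadow U) := fun i => by
    induction i with
    | zero => simp [hull_zero]
    | succ i ih =>
      rw [hull_succ, mul_add_one, add_comm, pow_add, mul_assoc]
      exact (volume_fill_le hs ht (measurableSet_hull U i)).trans (by gcongr)
  have h1 : 1 ≤ ENNReal.ofReal t / (1 - s) := by
    have h2 : (1 : ℝ≥0∞) ≤ ENNReal.ofReal t := by simpa using ht
    rw [ENNReal.le_div_iff_mul_le (Or.inl (tsub_pos_of_lt hs).ne')
      (Or.inl (tsub_le_self.trans_lt ENNReal.one_lt_top).ne), one_mul]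
    exact tsub_le_self.trans h2
  refine (h i).trans ?_
  gcongr

theorem dilate_subset_hull_succ (hs : s ≠ 0) {U : Set (DyadicRect n)} {i : ℕ} {R : DyadicRect n}
    (h : R.toSet ⊆ hull s t U i) : R.dilate t ⊆ hull s t U (i + 1) := by
  rw [hull_succ]
  refine dilate_subset_fill (measurableSet_hull U i) ?_
  rw [Set.sdiff_eq_empty.2 h, measure_empty]
  exact ENNReal.mul_pos (pow_ne_zero _ hs) R.volume_toSet_ne_zero

theorem toSet_subset_hull (hs : s ≠ 0) (ht : 1 ≤ t) {U : Set (DyadicRect n)} {R : DyadicRect n}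
    (hR : R ∈ U) (i : ℕ) : R.toSet ⊆ hull s t U i := by
  induction i with
  | zero => exact toSet_subset_shadow hR
  | succ i ih => exact (R.toSet_subset_dilate ht).trans (dilate_subset_hull_succ hs ih)

/-- The rectangles of `U` contained in a rectangle `Q`, with the same side in the direction `k`,
that lies in the `k`-th hull of `U`, while the expansion of `Q` by the factor `2 ^ (m + 1)` in the
direction `k` is not mostly filled by this hull. -/
def edgeClass (s : ℝ≥0∞) (t : ℝ) (U : Set (DyadicRect n)) (m : ℕ) (k : Fin n) :
    Set (DyadicRect n) :=
  {R | R ∈ U ∧ ∃ Q : DyadicRect n, R.toSet ⊆ Q.toSet ∧ Q k = R k ∧ Q.toSet ⊆ hull s t U k ∧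
    s ^ n * volume (DyadicRect.toSet (Function.update Q k ((Q k).ancestor (m + 1)))) ≤
      volume (DyadicRect.toSet (Function.update Q k ((Q k).ancestor (m + 1))) \ hull s t U k)}

/-- If every one-side extension were mostly filled, `n` fillings would absorb the dilate of the
fully raised rectangle, contradicting the choice of `m`. -/
theorem exists_mem_edgeClass (hn : 1 ≤ n) (hs : s ≠ 0) (ht : 1 ≤ t) {U : Set (DyadicRect n)}
    (hV : volume (hull s t U n) ≠ ⊤) {R : DyadicRect n} (hR : R ∈ U) :
    ∃ m k, R ∈ edgeClass s t U m k ∧ R.dilate (1 + (t - 1) * 2 ^ m) ⊆ hull s t U n := by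
  classical
  let anc : ℕ → DyadicRect n := fun M j => (R j).ancestor M
  -- The ancestors have unbounded volume, whereas the hull has finite volume.
  have hex : ∃ M, ¬(anc M).dilate t ⊆ hull s t U n := by
    by_contra! hcon
    have hlt : volume (hull s t U n) / volume R.toSet < ⊤ :=
      (ENNReal.div_ne_top hV R.volume_toSet_ne_zero).lt_top
    obtain ⟨M, hM⟩ := ENNReal.exists_nat_gt hlt.ne
    have h1 : (2 : ℝ≥0∞) ^ M * volume R.toSet ≤ volume (hull s t U n) := by
      calc _ ≤ ((2 : ℝ≥0∞) ^ M) ^ n * volume R.toSet := by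
            exact mul_le_mul' (le_self_pow₀ (one_le_pow₀ one_le_two) (Nat.one_le_iff_ne_zero.1 hn))
              le_rfl
        _ = volume (anc M).toSet := by
            rw [DyadicRect.volume_toSet, DyadicRect.volume_toSet]
            simp [anc, DyadicInterval.volume_ancestor, Finset.prod_mul_distrib]
        _ ≤ _ := measure_mono (((anc M).toSet_subset_dilate ht).trans (hcon M))
    have h2 : (2 : ℝ≥0∞) ^ M ≤ volume (hull s t U n) / volume R.toSet := by
      rwa [ENNReal.le_div_iff_mul_le (Or.inl R.volume_toSet_ne_zero)
        (Or.inl R.volume_toSet_ne_top)]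
    have h3 : (M : ℝ≥0∞) ≤ 2 ^ M := by exact_mod_cast Nat.lt_two_pow_self.le
    exact absurd (h3.trans h2) (not_le.2 hM)
  have hfind := Nat.find_spec hex
  have hmin : ∀ M < Nat.find hex, (anc M).dilate t ⊆ hull s t U n := fun M hM => by
    simpa using Nat.find_min hex hM
  -- Generation zero succeeds: `R` lies in the hull of index `n - 1`, so its dilate lies in the next
  -- one.
  have hne : Nat.find hex ≠ 0 := by
    intro h0
    rw [h0] at hfind
    refine hfind ?_
    have h0' : anc 0 = R := funext fun j => DyadicInterval.ancestor_zero _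
    have h := dilate_subset_hull_succ hs (toSet_subset_hull hs ht hR (n - 1))
    rwa [Nat.sub_add_cancel hn, ← h0'] at h
  obtain ⟨m, hm⟩ := Nat.exists_eq_succ_of_ne_zero hne
  rw [hm] at hfind hmin
  have hsub : R.dilate (1 + (t - 1) * 2 ^ m) ⊆ hull s t U n := by
    have h : R.dilate (1 + (t - 1) * 2 ^ m) ⊆ (anc m).dilate t := fun x hx j =>
      (R j).dilate_subset_dilate_ancestor m (by simp) (hx j)
    exact h.trans (hmin m (Nat.lt_succ_self m))
  suffices h : ∃ k, R ∈ edgeClass s t U m k by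
    obtain ⟨k, hk⟩ := h
    exact ⟨m, k, hk, hsub⟩
  by_contra! hcon
  -- The first `i` sides are raised; side `i` is still that of `R`, so `P i` can serve as the `Q` of
  -- `edgeClass`.
  let P : ℕ → DyadicRect n := fun i j => if j.1 < i then (R j).ancestor (m + 1) else R j
  have hPn : P n = anc (m + 1) := funext fun j => if_pos j.2
  have hP : ∀ i ≤ n, (P i).toSet ⊆ hull s t U i ∧ (0 < i → (P i).dilate t ⊆ hull s t U i) := by
    intro i
    induction i with
    | zero =>
      refine fun _ => ⟨?_, fun h => absurd h (lt_irrefl 0)⟩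
      have : P 0 = R := funext fun j => if_neg (Nat.not_lt_zero _)
      rw [this]
      exact toSet_subset_shadow hR
    | succ i ih =>
      intro hi
      obtain ⟨ih1, -⟩ := ih (by omega)
      set k : Fin n := ⟨i, hi⟩ with hk
      have hPk : P i k = R k := if_neg (lt_irrefl i)
      have hstep : P (i + 1) = Function.update (P i) k ((P i k).ancestor (m + 1)) := by
        funext j
        rcases eq_or_ne j k with rfl | hj
        · rw [Function.update_self, hPk]; exact if_pos (Nat.lt_succ_self i)
        · rw [Function.update_of_ne hj]
          have hj' : j.1 ≠ i := fun h => hj (Fin.ext h)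
          have : j.1 < i + 1 ↔ j.1 < i := by omega
          simp only [P, this]
      have hRP : R.toSet ⊆ (P i).toSet := fun x hx j => by
        by_cases hj : j.1 < i
        · simp only [P, hj, if_true]; exact (R j).toSet_subset_ancestor _ (hx j)
        · simp only [P, hj, if_false]; exact hx j
      have hlt : volume ((P (i + 1)).toSet \ hull s t U i) <
          s ^ n * volume (P (i + 1)).toSet := by
        by_contra! h
        exact hcon k ⟨hR, P i, hRP, hPk, ih1, by rw [← hstep]; exact h⟩
      have hd : (P (i + 1)).dilate t ⊆ hull s t U (i + 1) := by
        rw [hull_succ]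
        exact dilate_subset_fill (measurableSet_hull U i) hlt
      exact ⟨((P (i + 1)).toSet_subset_dilate ht).trans hd, fun _ => hd⟩
  refine hfind ?_
  have := (hP n le_rfl).2 (by omega)
  rwa [hPn] at this

/-- The edge set misses at most a proportion `1 - s ^ n` of each `Q`, so a filling with threshold
`s'` close to 1 recovers `Q`; no dilation is needed. -/
theorem shadow_edgeClass_subset {s' : ℝ≥0∞} (hs' : 1 - s ^ n < s' ^ n) (U : Set (DyadicRect n))
    (m : ℕ) (k : Fin n) (I : DyadicInterval) :
    shadow {R ∈ edgeClass s t U m k | R k = I} ⊆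
      fill s' 1 (edgeSet k (m + 1) (hull s t U k) I) := by
  refine Set.iUnion₂_subset fun R hR => ?_
  obtain ⟨⟨-, Q, hRQ, hQk, hQ, hlt⟩, rfl⟩ := hR
  refine hRQ.trans ?_
  have hA := measurableSet_hull (s := s) (t := t) U k
  have hE := measurableSet_edgeSet (k := k) (M := m + 1) hA (R k)
  rw [← DyadicRect.dilate_one]
  refine dilate_subset_fill hE ?_
  have h1 := le_volume_inter_edgeSet hA hQ hlt
  rw [hQk] at h1
  have h2 := measure_inter_add_sdiff (μ := volume) Q.toSet hE
  have hfin : volume (Q.toSet ∩ edgeSet k (m + 1) (hull s t U k) (R k)) ≠ ⊤ :=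
    measure_ne_top_of_subset Set.inter_subset_left Q.volume_toSet_ne_top
  calc _ = volume Q.toSet - volume (Q.toSet ∩ edgeSet k (m + 1) (hull s t U k) (R k)) :=
        ENNReal.eq_sub_of_add_eq hfin (by rw [add_comm, h2])
    _ ≤ volume Q.toSet - s ^ n * volume Q.toSet := tsub_le_tsub_left h1 _
    _ = (1 - s ^ n) * volume Q.toSet := by
        rw [ENNReal.sub_mul (fun _ _ => Q.volume_toSet_ne_top), one_mul]
    _ < _ := by
        rw [ENNReal.mul_lt_mul_iff_left Q.volume_toSet_ne_zero Q.volume_toSet_ne_top]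
        exact hs'

/-- The nonnegative function `g` on the dyadic rectangles satisfies the Carleson condition with
constant `B` for the collections with `n - 1` parameters. -/
def IsPredCarleson (B : ℝ≥0∞) (g : DyadicRect n → ℝ≥0∞) : Prop :=
  ∀ U : Set (DyadicRect n), HasPredParameters U → volume (shadow U) < ⊤ →
    ∑' R, U.indicator g R ≤ B * volume (shadow U)

variable {B : ℝ≥0∞} {g : DyadicRect n → ℝ≥0∞}

theorem tsum_edgeClass_le (hg : IsPredCarleson B g) {s' : ℝ≥0∞} (hs1 : s' < 1)
    (hs' : 1 - s ^ n < s' ^ n) {U : Set (DyadicRect n)} (hU : volume (shadow U) < ⊤) (m : ℕ)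
    (k : Fin n) :
    ∑' R, (edgeClass s t U m k).indicator g R ≤
      B * ((1 / (1 - s')) ^ n * ((m + 1) * volume (hull s t U k))) := by
  have hA := measurableSet_hull (s := s) (t := t) U k
  have hsplit : ∀ R, (edgeClass s t U m k).indicator g R =
      ∑' I, {R ∈ edgeClass s t U m k | R k = I}.indicator g R := fun R => by
    rw [tsum_eq_single (R k)]
    · by_cases h : R ∈ edgeClass s t U m k
      · have h' : R ∈ {R' ∈ edgeClass s t U m k | R' k = R k} := ⟨h, rfl⟩
        rw [Set.indicator_of_mem h, Set.indicator_of_mem h']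
      · rw [Set.indicator_of_notMem h, Set.indicator_of_notMem fun h' => h h'.1]
    · exact fun I hI => Set.indicator_of_notMem (fun h => hI h.2.symm) _
  calc _ = ∑' I, ∑' R, {R ∈ edgeClass s t U m k | R k = I}.indicator g R := by
        simp_rw [hsplit]; exact ENNReal.tsum_comm
    _ ≤ ∑' I, B * ((1 / (1 - s')) ^ n * volume (edgeSet k (m + 1) (hull s t U k) I)) := by
        refine ENNReal.tsum_le_tsum fun I => ?_
        have hsub : shadow {R ∈ edgeClass s t U m k | R k = I} ⊆ shadow U :=
          shadow_mono fun R hR => hR.1.1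
        refine (hg _ ⟨k, I, fun R hR => hR.2⟩ ((measure_mono hsub).trans_lt hU)).trans ?_
        gcongr
        refine (measure_mono (shadow_edgeClass_subset hs' U m k I)).trans ?_
        simpa using volume_fill_le hs1 le_rfl (measurableSet_edgeSet hA I)
    _ ≤ _ := by
        rw [ENNReal.tsum_mul_left, ENNReal.tsum_mul_left]
        gcongr
        simpa using tsum_volume_edgeSet_le (k := k) hA (M := m + 1) (by omega)

/-- **Journé's lemma**: a function satisfying the Carleson condition for the collections with
`n - 1` parameters satisfies it for all the collections once weighted by a factor that decays with
the embeddedness in the hull. -/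
theorem tsum_mul_le_of_hull (hn : 1 ≤ n) (hg : IsPredCarleson B g) {s' : ℝ≥0∞} (hs0 : s ≠ 0)
    (hs : s < 1) (ht : 1 ≤ t) (hs1 : s' < 1) (hs' : 1 - s ^ n < s' ^ n) {U : Set (DyadicRect n)}
    (hU : volume (shadow U) < ⊤) {a : DyadicRect n → ℝ≥0∞} {c : ℝ≥0∞}
    (ha : ∀ R ∈ U, ∀ m : ℕ, R.dilate (1 + (t - 1) * 2 ^ m) ⊆ hull s t U n → a R ≤ c * (4⁻¹) ^ m) :
    ∑' R, U.indicator (fun R => a R * g R) R ≤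
      2 * n * c * (1 / (1 - s')) ^ n * (ENNReal.ofReal t / (1 - s)) ^ (n * n) * B *
        volume (shadow U) := by
  set D := (ENNReal.ofReal t / (1 - s)) ^ (n * n) with hD
  set L := (1 / (1 - s')) ^ n with hL
  have hDtop : D ≠ ⊤ := ENNReal.pow_ne_top
    (ENNReal.div_ne_top ENNReal.ofReal_ne_top (tsub_pos_of_lt hs).ne')
  have hV : volume (hull s t U n) ≠ ⊤ :=
    ((volume_hull_le hs ht U le_rfl).trans_lt (ENNReal.mul_lt_top hDtop.lt_top hU)).ne
  -- One class containing `R` suffices, so the sum over all classes is an upper bound even if they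
  -- overlap.
  have hpt : ∀ R, U.indicator (fun R => a R * g R) R ≤
      ∑' m : ℕ, ∑ k : Fin n, c * (4⁻¹) ^ m * (edgeClass s t U m k).indicator g R := fun R => by
    by_cases hR : R ∈ U
    · obtain ⟨m, k, hmk, hsub⟩ := exists_mem_edgeClass hn hs0 ht hV hR
      rw [Set.indicator_of_mem hR]
      calc a R * g R ≤ c * (4⁻¹) ^ m * (edgeClass s t U m k).indicator g R := by
            rw [Set.indicator_of_mem hmk]
            gcongr
            exact ha R hR m hsub
        _ ≤ ∑ k : Fin n, c * (4⁻¹) ^ m * (edgeClass s t U m k).indicator g R :=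
            Finset.single_le_sum
              (f := fun k => c * (4⁻¹) ^ m * (edgeClass s t U m k).indicator g R)
              (fun _ _ => zero_le) (Finset.mem_univ k)
        _ ≤ _ := ENNReal.le_tsum m
    · rw [Set.indicator_of_notMem hR]; exact zero_le
  calc _ ≤ ∑' R, ∑' m : ℕ, ∑ k : Fin n,
          c * (4⁻¹) ^ m * (edgeClass s t U m k).indicator g R := ENNReal.tsum_le_tsum hpt
    _ = ∑' m : ℕ, ∑ k : Fin n, c * (4⁻¹) ^ m * ∑' R, (edgeClass s t U m k).indicator g R := by
        rw [ENNReal.tsum_comm]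
        refine tsum_congr fun m => ?_
        rw [Summable.tsum_finsetSum fun _ _ => ENNReal.summable]
        exact Finset.sum_congr rfl fun k _ => ENNReal.tsum_mul_left
    -- The overlap count `m + 1` is bounded by `2 ^ m`, which leaves a geometric series of ratio `1
    -- / 2`.
    _ ≤ ∑' m : ℕ, ∑ k : Fin n, c * (4⁻¹) ^ m * (B * (L * (2 ^ m * (D * volume (shadow U))))) := by
        gcongr with m k
        refine (tsum_edgeClass_le hg hs1 hs' hU m k).trans ?_
        gcongr
        · exact_mod_cast Nat.lt_two_pow_self
        · exact volume_hull_le hs ht U k.2.le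
    _ = ∑' m : ℕ, (2⁻¹) ^ m * (n * c * L * D * B * volume (shadow U)) := by
        refine tsum_congr fun m => ?_
        have h42 : (4⁻¹ : ℝ≥0∞) ^ m * 2 ^ m = (2⁻¹) ^ m := by
          rw [← mul_pow]
          congr 1
          rw [show (4 : ℝ≥0∞) = 2 * 2 by norm_num, ENNReal.mul_inv (by simp) (by simp), mul_assoc,
            ENNReal.inv_mul_cancel (by simp) (by simp), mul_one]
        rw [Finset.sum_const, Finset.card_univ, Fintype.card_fin, nsmul_eq_mul, ← h42]
        ring
    _ = _ := by
        rw [ENNReal.tsum_mul_right, ENNReal.tsum_geometric, ENNReal.one_sub_inv_two, inv_inv]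
        ring

end Hull

/-! ### Product wavelets in `L²` -/

namespace IsOrthonormalWavelet

variable {n : ℕ} {w : ℝ → ℂ}

theorem aestronglyMeasurable_waveletOn (hw : IsOrthonormalWavelet w) (I : DyadicInterval) :
    AEStronglyMeasurable (waveletOn w I) volume := by
  have h1 : Measure.QuasiMeasurePreserving (fun x : ℝ => x - I.center) volume volume :=
    (measurePreserving_sub_right volume I.center).quasiMeasurePreserving
  have h2 : Measure.QuasiMeasurePreserving (fun x : ℝ => x * I.length⁻¹) volume volume := by
    refine ⟨measurable_mul_const _, ?_⟩
    rw [Real.map_volume_mul_right (inv_ne_zero I.length_pos.ne')]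
    exact Measure.smul_absolutelyContinuous
  exact (hw.memLp.aestronglyMeasurable.comp_quasiMeasurePreserving (h2.comp h1)).const_mul _

theorem memLp_waveletOn (hw : IsOrthonormalWavelet w) (I : DyadicInterval) :
    MemLp (waveletOn w I) 2 volume := by
  rw [memLp_two_iff_integrable_sq_norm (hw.aestronglyMeasurable_waveletOn I)]
  have h : Integrable (fun x => waveletOn w I x * (starRingEnd ℂ) (waveletOn w I x)) volume := by
    -- A Bochner integral that fails to converge is 0 by convention, while this one equals 1.
    by_contra hcon
    have := hw.norm_one I
    rw [integral_undef hcon] at this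
    exact zero_ne_one this
  refine h.norm.congr (Eventually.of_forall fun x => ?_)
  simp [sq]

theorem memLp_prodWavelet (hw : IsOrthonormalWavelet w) (R : DyadicRect n) :
    MemLp (prodWavelet w R) 2 volume := by
  have hm : AEStronglyMeasurable (prodWavelet w R) volume := by
    have := Finset.aestronglyMeasurable_prod (μ := (volume : Measure (Fin n → ℝ))) Finset.univ
      (f := fun j (x : Fin n → ℝ) => waveletOn w (R j) (x j)) fun j _ =>
        (hw.aestronglyMeasurable_waveletOn (R j)).comp_quasiMeasurePreserving
          (Measure.quasiMeasurePreserving_eval (fun _ => volume) j)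
    refine this.congr (Eventually.of_forall fun x => ?_)
    simp [prodWavelet]
  rw [memLp_two_iff_integrable_sq_norm hm]
  have : Integrable (fun x : Fin n → ℝ => ∏ j, ‖waveletOn w (R j) (x j)‖ ^ 2) volume :=
    Integrable.fintype_prod (f := fun j x => ‖waveletOn w (R j) x‖ ^ 2) fun j =>
      (memLp_two_iff_integrable_sq_norm (hw.aestronglyMeasurable_waveletOn (R j))).1
        (hw.memLp_waveletOn (R j))
  refine this.congr (Eventually.of_forall fun x => ?_)
  simp [prodWavelet, norm_prod, Finset.prod_pow]

/-- The product wavelet as an element of `L²`. -/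
def toLp (hw : IsOrthonormalWavelet w) (R : DyadicRect n) : Lp ℂ 2 (volume : Measure (Fin n → ℝ)) :=
  (hw.memLp_prodWavelet R).toLp (prodWavelet w R)

theorem inner_toLp (hw : IsOrthonormalWavelet w) (R : DyadicRect n)
    (F : Lp ℂ 2 (volume : Measure (Fin n → ℝ))) :
    inner ℂ (hw.toLp R) F = waveletCoeff w F R := by
  rw [L2.inner_def, waveletCoeff]
  refine integral_congr_ae ?_
  filter_upwards [(hw.memLp_prodWavelet R).coeFn_toLp] with x hx
  rw [toLp, hx, RCLike.inner_apply]

theorem waveletCoeff_prodWavelet (hw : IsOrthonormalWavelet w) (R S : DyadicRect n) :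
    waveletCoeff w (prodWavelet w S) R = if R = S then 1 else 0 := by
  have : waveletCoeff w (prodWavelet w S) R =
      ∏ j, ∫ x, waveletOn w (S j) x * (starRingEnd ℂ) (waveletOn w (R j) x) := by
    rw [← integral_fintype_prod_volume_eq_prod, waveletCoeff]
    simp [prodWavelet, Finset.prod_mul_distrib]
  rw [this]
  split_ifs with h
  · subst h
    exact Finset.prod_eq_one fun j _ => hw.norm_one _
  · obtain ⟨j, hj⟩ := Function.ne_iff.1 h
    exact Finset.prod_eq_zero (Finset.mem_univ j) (hw.orthogonal _ _ hj.symm)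

theorem orthonormal_toLp (hw : IsOrthonormalWavelet w) :
    Orthonormal ℂ (hw.toLp : DyadicRect n → Lp ℂ 2 (volume : Measure (Fin n → ℝ))) := by
  rw [orthonormal_iff_ite]
  intro R S
  rw [inner_toLp, ← waveletCoeff_prodWavelet hw R S]
  refine integral_congr_ae ?_
  filter_upwards [(hw.memLp_prodWavelet S).coeFn_toLp] with x hx
  rw [toLp, hx]

/-- A square summable family of coefficients is the family of wavelet coefficients of the sum of
its wavelet series. -/
theorem exists_isL2Sum (hw : IsOrthonormalWavelet w) (U : Set (DyadicRect n))
    (a : DyadicRect n → ℂ) (ha : ∑' R : U, ‖a R‖ₑ ^ 2 ≠ ⊤) :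
    ∃ f : (Fin n → ℝ) → ℂ, IsL2Sum (fun (R : U) x => a R.1 * prodWavelet w R.1 x) f ∧
      ∀ R, waveletCoeff w f R = U.indicator a R := by
  classical
  have hv : Orthonormal ℂ fun R : U => hw.toLp R.1 :=
    hw.orthonormal_toLp.comp _ Subtype.val_injective
  have hsq : Summable fun R : U => ‖a R.1‖ ^ 2 := by
    have := ENNReal.summable_toReal ha
    simpa using this
  have hsum : Summable fun R : U => a R.1 • hw.toLp R.1 :=
    (hv.orthogonalFamily.summable_iff_norm_sq_summable fun R : U => a R.1).2 hsq
  obtain ⟨F, hF⟩ := hsum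
  refine ⟨F, ⟨Lp.memLp F, ?_⟩, fun R => ?_⟩
  · have hfin : ∀ s : Finset U, ((∑ R ∈ s, a R.1 • hw.toLp R.1 : Lp ℂ 2 _) : (Fin n → ℝ) → ℂ)
        =ᵐ[volume] fun x => ∑ R ∈ s, a R.1 * prodWavelet w R.1 x := fun s => by
      induction s using Finset.induction_on with
      | empty =>
        simp only [Finset.sum_empty]
        exact Lp.coeFn_zero _ _ _
      | insert R s hR ih =>
        simp only [Finset.sum_insert hR]
        filter_upwards [Lp.coeFn_add (a R.1 • hw.toLp R.1) (∑ R ∈ s, a R.1 • hw.toLp R.1), ih,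
          Lp.coeFn_smul (a R.1) (hw.toLp R.1), (hw.memLp_prodWavelet R.1).coeFn_toLp]
          with x h1 h2 h3 h4
        rw [h1, Pi.add_apply, h2, h3, Pi.smul_apply, toLp, h4, smul_eq_mul]
    have ht := tendsto_iff_edist_tendsto_0.1 (show Tendsto _ _ (𝓝 F) from hF)
    refine ht.congr fun s => ?_
    rw [edist_comm, Lp.edist_def]
    refine eLpNorm_congr_ae ?_
    filter_upwards [hfin s] with x hx
    rw [Pi.sub_apply, hx]
  · rw [← hw.inner_toLp]
    have h1 : HasSum (fun S : U => inner ℂ (hw.toLp R) (a S.1 • hw.toLp S.1))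
        (inner ℂ (hw.toLp R) F) := hF.mapL (innerSL ℂ (hw.toLp R))
    have h2 : ∀ S : U, inner ℂ (hw.toLp R) (a S.1 • hw.toLp S.1) =
        if R = S.1 then a S.1 else 0 := fun S => by
      rw [inner_smul_right, orthonormal_iff_ite.1 hw.orthonormal_toLp R S.1]
      simp
    simp_rw [h2] at h1
    refine h1.unique ?_
    by_cases hR : R ∈ U
    · rw [Set.indicator_of_mem hR]
      convert! hasSum_single (⟨R, hR⟩ : U) fun S hS => ?_
      · simp
      · exact if_neg fun h => hS (Subtype.ext h.symm)
    · rw [Set.indicator_of_notMem hR]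
      have hne : ∀ S : U, R ≠ S.1 := fun S h => hR (by rw [h]; exact S.2)
      simp [hne]

end IsOrthonormalWavelet

/-! ### The weighted wavelet series -/

section Embeddedness

variable {n : ℕ}

/-- The largest dilation factor for which the dilate of `R` remains in `V`. -/
def embeddedness (V : Set (Fin n → ℝ)) (R : DyadicRect n) : ℝ :=
  sSup {t | 1 ≤ t ∧ R.dilate t ⊆ V}

variable {V : Set (Fin n → ℝ)} {R : DyadicRect n}

/-- As `n ≥ 1`, the dilate by `t ≥ 1` has volume at least `t * |R|`, which cannot exceed that of
`V`. -/
theorem bddAbove_setOf_dilate_subset (hn : 1 ≤ n) (hV : volume V < ⊤) :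
    BddAbove {t | 1 ≤ t ∧ R.dilate t ⊆ V} := by
  refine ⟨(volume V / volume R.toSet).toReal, fun t ht => ?_⟩
  rw [← ENNReal.ofReal_le_iff_le_toReal (ENNReal.div_ne_top hV.ne R.volume_toSet_ne_zero),
    ENNReal.le_div_iff_mul_le (Or.inl R.volume_toSet_ne_zero) (Or.inl R.volume_toSet_ne_top)]
  have h1 : (1 : ℝ≥0∞) ≤ ENNReal.ofReal t := by simpa using ht.1
  calc _ ≤ ENNReal.ofReal t ^ n * volume R.toSet :=
        mul_le_mul' (le_self_pow₀ h1 (Nat.one_le_iff_ne_zero.1 hn)) le_rfl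
    _ = volume (R.dilate t) := (R.volume_dilate (zero_le_one.trans ht.1)).symm
    _ ≤ _ := measure_mono ht.2

theorem le_embeddedness (hn : 1 ≤ n) (hV : volume V < ⊤) {t : ℝ} (ht : 1 ≤ t)
    (h : R.dilate t ⊆ V) : t ≤ embeddedness V R :=
  le_csSup (bddAbove_setOf_dilate_subset hn hV) ⟨ht, h⟩

/-- The supremum is attained: dilates are open, so a point of the limiting dilate already lies in an
admissible one. -/
theorem dilate_embeddedness_subset (hn : 1 ≤ n) (hV : volume V < ⊤) (hR : R.toSet ⊆ V) :
    R.dilate (embeddedness V R) ⊆ V := by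
  intro x hx
  have hopen : IsOpen {t : ℝ | x ∈ R.dilate t} := by
    have : {t : ℝ | x ∈ R.dilate t} = ⋂ j, {t : ℝ | x j ∈ (R j).dilate t} := by
      ext t; simp [DyadicRect.mem_dilate]
    rw [this]
    refine isOpen_iInter_of_finite fun j => ?_
    have h1 : Continuous fun t : ℝ => (R j).center - t * (R j).length / 2 := by fun_prop
    have h2 : Continuous fun t : ℝ => (R j).center + t * (R j).length / 2 := by fun_prop
    exact (isOpen_lt h1 continuous_const).inter (isOpen_lt continuous_const h2)
  have hne : {t | 1 ≤ t ∧ R.dilate t ⊆ V}.Nonempty := ⟨1, le_rfl, by rwa [R.dilate_one]⟩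
  obtain ⟨t, ht, ht'⟩ := mem_closure_iff.1
    (csSup_mem_closure hne (bddAbove_setOf_dilate_subset hn hV)) _ hopen hx
  exact ht'.2 ht

end Embeddedness

/-! ### Passing between the norms and Carleson sums -/

theorem isPredCarleson_waveletCoeff {n : ℕ} (w : ℝ → ℂ) (b : (Fin n → ℝ) → ℂ) :
    IsPredCarleson (bmoPredNorm w b ^ 2) fun R => ‖waveletCoeff w b R‖ₑ ^ 2 := by
  intro U hU hfin
  rw [← tsum_subtype U fun R => ‖waveletCoeff w b R‖ₑ ^ 2]
  rcases U.eq_empty_or_nonempty with rfl | ⟨R, hR⟩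
  · simp
  have h0 : volume (shadow U) ≠ 0 := fun h =>
    R.volume_toSet_ne_zero (measure_mono_null (toSet_subset_shadow hR) h)
  have h : ((∑' R : U, ‖waveletCoeff w b R.1‖ₑ ^ 2) / volume (shadow U)) ^ (1 / 2 : ℝ) ≤
      bmoPredNorm w b :=
    le_iSup_of_le U (le_iSup_of_le hU (le_iSup_of_le hfin le_rfl))
  rw [← ENNReal.div_le_iff h0 hfin.ne]
  calc _ = (((∑' R : U, ‖waveletCoeff w b R.1‖ₑ ^ 2) / volume (shadow U)) ^ (1 / 2 : ℝ)) ^ 2 := by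
        rw [← ENNReal.rpow_natCast, ← ENNReal.rpow_mul]; norm_num
    _ ≤ _ := by gcongr

theorem bmoNorm_le_of_forall {n : ℕ} {w : ℝ → ℂ} {f : (Fin n → ℝ) → ℂ} {C B : ℝ≥0∞}
    (h : ∀ W : Set (Fin n → ℝ), IsOpen W → volume W < ⊤ →
      ∑' R : {R : DyadicRect n // R.toSet ⊆ W}, ‖waveletCoeff w f R.1‖ₑ ^ 2 ≤
        C * B ^ 2 * volume W) :
    bmoNorm w f ≤ C ^ (1 / 2 : ℝ) * B := by
  refine iSup_le fun W => iSup_le fun hW => iSup_le fun hfin => ?_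
  calc _ ≤ (C * B ^ 2) ^ (1 / 2 : ℝ) := by
        gcongr
        exact ENNReal.div_le_of_le_mul (h W hW hfin)
    _ = _ := by
        rw [ENNReal.mul_rpow_of_nonneg _ _ (by norm_num), ← ENNReal.rpow_natCast,
          ← ENNReal.rpow_mul]
        norm_num

/-! ### Constants and the decay of the weights -/

theorem exists_div_one_sub_pow_le (N : ℕ) {δ : ℝ} (hδ : 0 < δ) :
    ∃ η : ℝ, 0 < η ∧ η < 1 ∧
      (ENNReal.ofReal (1 + η) / (1 - ENNReal.ofReal η)) ^ N ≤ ENNReal.ofReal (1 + δ) := by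
  have hc : ContinuousAt (fun η : ℝ => ((1 + η) / (1 - η)) ^ N) 0 := by
    refine ContinuousAt.pow (ContinuousAt.div (by fun_prop) (by fun_prop) (by norm_num)) N
  have h1 : ∀ᶠ η in 𝓝 (0 : ℝ), ((1 + η) / (1 - η)) ^ N < 1 + δ :=
    hc.eventually_lt continuousAt_const (by simpa using hδ)
  have h2 : ∀ᶠ η in 𝓝 (0 : ℝ), η < 1 := eventually_lt_nhds one_pos
  obtain ⟨η, ⟨h1, h2⟩, h0⟩ :=
    (((h1.and h2).filter_mono nhdsWithin_le_nhds).and (self_mem_nhdsWithin (s := Set.Ioi 0))).exists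
  have h0 : 0 < η := h0
  refine ⟨η, h0, h2, ?_⟩
  rw [← ENNReal.ofReal_one, ← ENNReal.ofReal_sub _ h0.le,
    ← ENNReal.ofReal_div_of_pos (by linarith), ← ENNReal.ofReal_pow
      (div_nonneg (by linarith) (by linarith))]
  exact ENNReal.ofReal_le_ofReal h1.le

theorem exists_lt_one_lt_pow (n : ℕ) {a : ℝ≥0∞} (ha : a < 1) : ∃ s < 1, a < s ^ n := by
  have hc : ContinuousAt (fun s : ℝ≥0∞ => s ^ n) 1 := (ENNReal.continuous_pow n).continuousAt
  have h1 : ∀ᶠ s in 𝓝 (1 : ℝ≥0∞), a < s ^ n :=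
    continuousAt_const.eventually_lt hc (by simpa using ha)
  have : (𝓝[<] (1 : ℝ≥0∞)).NeBot := nhdsLT_neBot_of_exists_lt ⟨0, one_pos⟩
  obtain ⟨s, hs, hs1⟩ :=
    ((h1.filter_mono nhdsWithin_le_nhds).and (self_mem_nhdsWithin (s := Set.Iio 1))).exists
  exact ⟨s, hs1, hs⟩

/-- The weights given by the negative powers of the embeddedness decay geometrically. -/
theorem enorm_rpow_neg_sq_le {e p η : ℝ} {m : ℕ} (hp : 1 ≤ p) (hη : 0 < η)
    (he : 1 + η * 2 ^ m ≤ e) :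
    ‖((e ^ (-p) : ℝ) : ℂ)‖ₑ ^ 2 ≤ ENNReal.ofReal (η⁻¹ ^ 2) * (4⁻¹) ^ m := by
  have hpos : 0 < η * 2 ^ m := by positivity
  have he1 : 1 ≤ e := by linarith
  -- The first power of `e` is enough: its square decays like `4 ^ (-m)`, which beats the overlap `m
  -- + 1`.
  have h1 : e ^ (-p) ≤ η⁻¹ * (2 ^ m)⁻¹ := by
    calc e ^ (-p) ≤ e ^ (-1 : ℝ) := Real.rpow_le_rpow_of_exponent_le he1 (by linarith)
      _ = e⁻¹ := Real.rpow_neg_one e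
      _ ≤ (η * 2 ^ m)⁻¹ := inv_anti₀ hpos (by linarith)
      _ = _ := mul_inv _ _
  have h0 : 0 ≤ e ^ (-p) := Real.rpow_nonneg (by linarith) _
  have h4 : ENNReal.ofReal ((4 ^ m)⁻¹) = (4⁻¹) ^ m := by
    rw [ENNReal.ofReal_inv_of_pos (by positivity), ENNReal.ofReal_pow (by norm_num),
      ENNReal.inv_pow]
    simp
  rw [← ofReal_norm, Complex.norm_real, Real.norm_of_nonneg h0, ← ENNReal.ofReal_pow h0,
    ← h4, ← ENNReal.ofReal_mul (by positivity)]
  refine ENNReal.ofReal_le_ofReal ?_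
  calc (e ^ (-p)) ^ 2 ≤ (η⁻¹ * (2 ^ m)⁻¹) ^ 2 := by gcongr
    _ = _ := by
      rw [mul_pow, inv_pow (2 ^ m), ← pow_mul, mul_comm m, pow_mul]
      norm_num

end

theorem lemmal (n : ℕ) (hn : 1 ≤ n) (δ ε : ℝ) (hδ : 0 < δ) (hε : 0 < ε) :
    ∃ K : ℝ≥0, ∀ w : ℝ → ℂ, IsOrthonormalWavelet w →
      ∀ b : (Fin n → ℝ) → ℂ, HasWaveletCoeffs w b → bmoPredNorm w b < ⊤ →
      ∀ U : Set (DyadicRect n), volume (shadow U) < ⊤ →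
      ∃ (V : Set (Fin n → ℝ)) (emb : DyadicRect n → ℝ),
        MeasurableSet V ∧ shadow U ⊆ V ∧
        volume V ≤ ENNReal.ofReal (1 + δ) * volume (shadow U) ∧
        (∀ R ∈ U, 1 ≤ emb R ∧ R.dilate (emb R) ⊆ V) ∧
        ∃ f : (Fin n → ℝ) → ℂ,
          IsL2Sum (fun (R : U) x =>
            ((emb R.1 ^ (-((n : ℝ) + ε)) : ℝ) : ℂ) * waveletCoeff w b R.1 *
              prodWavelet w R.1 x) f ∧
          bmoNorm w f ≤ (K : ℝ≥0∞) * bmoPredNorm w b := by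
  -- The exponent `n * n` counts `n` fillings, each made of `n` one-directional expansions.
  obtain ⟨η, hη0, hη1, hη⟩ := exists_div_one_sub_pow_le (n * n) hδ
  set s : ℝ≥0∞ := ENNReal.ofReal η with hs
  have hs0 : s ≠ 0 := by simpa [hs] using hη0
  have hs1 : s < 1 := by simpa [hs] using hη1
  have ht : 1 ≤ 1 + η := by linarith
  obtain ⟨s', hs'1, hs'⟩ := exists_lt_one_lt_pow n
    (ENNReal.sub_lt_self ENNReal.one_ne_top one_ne_zero (pow_ne_zero n hs0))
  set C : ℝ≥0∞ := 2 * n * ENNReal.ofReal (η⁻¹ ^ 2) * (1 / (1 - s')) ^ n *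
    (ENNReal.ofReal (1 + η) / (1 - s)) ^ (n * n) with hC
  have hCtop : C ≠ ⊤ := by
    refine ENNReal.mul_ne_top (ENNReal.mul_ne_top (ENNReal.mul_ne_top
      (ENNReal.mul_ne_top (by simp) (by simp)) ENNReal.ofReal_ne_top)
      (ENNReal.pow_ne_top ?_)) (hη.trans_lt ENNReal.ofReal_lt_top).ne
    exact ENNReal.div_ne_top ENNReal.one_ne_top (tsub_pos_of_lt hs'1).ne'
  refine ⟨(C ^ (1 / 2 : ℝ)).toNNReal, fun w hw b _ hb U hU => ?_⟩
  rw [ENNReal.coe_toNNReal (ENNReal.rpow_ne_top_of_nonneg (by norm_num) hCtop)]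
  set V := hull s (1 + η) U n with hV
  have hVle : volume V ≤ ENNReal.ofReal (1 + δ) * volume (shadow U) :=
    (volume_hull_le hs1 ht U le_rfl).trans (by gcongr)
  have hVtop : volume V < ⊤ := hVle.trans_lt (ENNReal.mul_lt_top ENNReal.ofReal_lt_top hU)
  have hUV : ∀ R ∈ U, R.toSet ⊆ V := fun R hR => toSet_subset_hull hs0 ht hR n
  set a : DyadicRect n → ℂ := fun R =>
    ((embeddedness V R ^ (-((n : ℝ) + ε)) : ℝ) : ℂ) * waveletCoeff w b R with ha
  have hp : 1 ≤ (n : ℝ) + ε := by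
    have : (1 : ℝ) ≤ n := by exact_mod_cast hn
    linarith
  -- The weights come from the hull of `U` but the bound has the shadow of `U'`: monotonicity of
  -- hulls makes this legitimate. `U' = U` gives square summability, `U' = {R ∈ U | R.toSet ⊆ W}`
  -- the BMO bound.
  have hsum : ∀ U' ⊆ U, ∑' R, U'.indicator (fun R => ‖a R‖ₑ ^ 2) R ≤
      C * bmoPredNorm w b ^ 2 * volume (shadow U') := fun U' hU' => by
    simp_rw [ha, enorm_mul, mul_pow]
    refine tsum_mul_le_of_hull hn (isPredCarleson_waveletCoeff w b) hs0 hs1 ht hs'1 hs'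
      ((measure_mono (shadow_mono hU')).trans_lt hU) fun R _ m hsub => ?_
    rw [add_sub_cancel_left] at hsub
    have h0 : 0 ≤ η * 2 ^ m := by positivity
    exact enorm_rpow_neg_sq_le hp hη0 (le_embeddedness hn hVtop (by linarith)
      (hsub.trans (hull_mono hU' n)))
  have hfin : ∑' R : U, ‖a R‖ₑ ^ 2 ≠ ⊤ := by
    rw [tsum_subtype U fun R => ‖a R‖ₑ ^ 2]
    exact ((hsum U subset_rfl).trans_lt (ENNReal.mul_lt_top
      (ENNReal.mul_lt_top hCtop.lt_top (ENNReal.pow_lt_top hb)) hU)).ne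
  obtain ⟨f, hf, hcoeff⟩ := hw.exists_isL2Sum U a hfin
  refine ⟨V, embeddedness V, measurableSet_hull U n, Set.iUnion₂_subset hUV, hVle,
    fun R hR => ⟨le_embeddedness hn hVtop le_rfl (by rw [R.dilate_one]; exact hUV R hR),
      dilate_embeddedness_subset hn hVtop (hUV R hR)⟩, f, hf, ?_⟩
  refine bmoNorm_le_of_forall fun W _ _ => ?_
  set U' : Set (DyadicRect n) := {R ∈ U | R.toSet ⊆ W} with hU'
  calc ∑' R : {R : DyadicRect n // R.toSet ⊆ W}, ‖waveletCoeff w f R.1‖ₑ ^ 2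
      = ∑' R, {R : DyadicRect n | R.toSet ⊆ W}.indicator (fun R => ‖waveletCoeff w f R‖ₑ ^ 2) R :=
        tsum_subtype {R : DyadicRect n | R.toSet ⊆ W} fun R => ‖waveletCoeff w f R‖ₑ ^ 2
    _ = ∑' R, U'.indicator (fun R => ‖a R‖ₑ ^ 2) R := by
        refine tsum_congr fun R => ?_
        simp only [hcoeff, hU']
        by_cases h1 : R ∈ U <;> by_cases h2 : R.toSet ⊆ W <;> simp [h1, h2]
    _ ≤ C * bmoPredNorm w b ^ 2 * volume (shadow U') := hsum U' fun R hR => hR.1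
    _ ≤ _ := by
        gcongr
        exact Set.iUnion₂_subset fun R hR => hR.2
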